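/- Let $G=(V,E,w)$ be a weighted hypergraph with vertex set $V=\{v_1,\dots,v_N\}$, non-empty finite edge set $E$ of subsets of $V$, each of cardinality at least $2$, and weights $w:E\to\mathbb{R}_{>0}$. Let $\deg v=\sum_{e\in E:\,v\in e}w(e)$, assume $\deg v>0$ for every $v\in V$ (no isolated vertices), and let $\nabla=\max_{e\in E}|e|$. For $1\le r\le\nabla$ let $N(r,\nabla)$ be $\frac1r$ times the number of surjections $\{1,\dots,\nabla\}\to\{1,\dots,r\}$. The adjacency tensor $A$ has entries $A_{i_1,\dots,i_\nabla}=w(e)/N(|e|,\nabla)$ if $e=\{v_{i_1},\dots,v_{i_\nabla}\}\in E$ (as a set, ignoring repetitions), and $0$ otherwise. The normalized Laplacian $L$, the random walk Laplacian $\mathcal L$ and their signless versions $L^+$, $\mathcal L^+$ are the $\nabla$-th order $N$-dimensional tensors with all diagonal entries (those with $i_1=\dots=i_\nabla$) equal to $1$ and with off-diagonal entries \[ L_{i_1,\dots,i_\nabla}=-A_{i_1,\dots,i_\nabla}\prod_{l=1}^{\nabla}\frac{1}{\sqrt[\nabla]{\deg v_{i_l}}},\qquad \mathcal L_{i_1,\dots,i_\nabla}=-\frac{A_{i_1,\dots,i_\nabla}}{\deg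 v_{i_1}},\qquad L^+_{i_1,\dots,i_\nabla}=-L_{i_1,\dots,i_\nabla},\qquad \mathcal L^+_{i_1,\dots,i_\nabla}=-\mathcal L_{i_1,\dots,i_\nabla}. \] For a $k$-th order $N$-dimensional complex tensor $T$, $k\ge2$, a pair $(\lambda,\mathbf x)\in\mathbb C\times(\mathbb C^N\setminus\{0\})$ is an eigenpair (and $\lambda$ an eigenvalue with eigenvector $\mathbf x$) if $\sum_{i_2,\dots,i_k}T_{i,i_2,\dots,i_k}x_{i_2}\cdots x_{i_k}=\lambda x_i^{k-1}$ for all $i$. The characteristic polynomial of $T$ is $\varphi_T(\lambda)=\det(T-\lambda\,\mathrm{id})$, where $\mathrm{id}$ is the unit tensor (with $1$ at the diagonal entries and $0$ elsewhere) and $\det S$ is the resultant of the $N$ forms $\sum_{i_2,\dots,i_k}S_{i,i_2,\dots,i_k}x_{i_2}\cdots x_{i_k}$, normalized so that $\det(\mathrm{id})=1$. The algebraic multiplicity of $\lambda$ is its multiplicity as a root of $\varphi_T$; the spectrum of $T$ is the multiset of roots of $\varphi_T$; the geometric multiplicity of $\lambda$ is the dimension of the variety of its eigenvectors; the span multiplicity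 of $\lambda$ is the dimension of the complex linear span of its eigenvectors; and the $H$-spectrum of $T$ is the set of real $\lambda$ that have an eigenvector in $\mathbb R^N$. Then: 1. $L$ and $\mathcal L$ have the same eigenvalues, counted with algebraic multiplicity: they have the same spectrum and the same set of eigenvalues, and every $\lambda\in\mathbb C$ has the same algebraic multiplicity for both. 2. For all $\lambda\in\mathbb C$ and $\mathbf x\in\mathbb C^N$, $(\lambda,\mathbf x)$ is an eigenpair for $L$ if and only if $(\lambda,\mathbf y)$ is an eigenpair for $\mathcal L$, where $y_j=x_j/\sqrt[\nabla]{\deg v_j}$ for $j=1,\dots,N$. 3. The eigenvalues of $L$ and $\mathcal L$ have the same geometric multiplicities and the same span multiplicities, and $L$ and $\mathcal L$ have the same $H$-spectrum. 4. Statements 1–3 also hold with $L$, $\mathcal L$ replaced by $L^+$, $\mathcal L^+$. -/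

import Mathlib

namespace HypergraphTensor

noncomputable section

/-! ### The resultant of `n` forms of degree `d` in `n` variables

The resultant is built in the classical way of Macaulay: it is the greatest common divisor, in the
polynomial ring of the indeterminate coefficients, of the Macaulay determinants in degree
`n * (d - 1) + 1` for all orderings of the variables, normalized to take the value `1` on the
system `x_1 ^ d, …, x_n ^ d`. -/

/-- The ring `ℂ[u_{i,γ}]` of the indeterminate coefficients; `u_{i,γ}` is the coefficient of the
monomial `x ^ γ` in the `i`-th form. -/
abbrev CoeffRing (n : ℕ) : Type := MvPolynomial (Fin n × (Fin n →₀ ℕ)) ℂ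

/-- The `i`-th generic form of degree `d`, `∑_{|γ| = d} u_{i,γ} x ^ γ`. -/
def genericForm (n d : ℕ) (i : Fin n) : MvPolynomial (Fin n) (CoeffRing n) :=
  ∑ γ ∈ Finset.finsuppAntidiag Finset.univ d, MvPolynomial.monomial γ (MvPolynomial.X (i, γ))

/-- The monomials in `n` variables of the critical degree `n * (d - 1) + 1`. -/
abbrev CriticalMonomial (n d : ℕ) : Type :=
  {α : Fin n →₀ ℕ // α ∈ Finset.finsuppAntidiag (Finset.univ : Finset (Fin n)) (n * (d - 1) + 1)}

/-- A monomial of critical degree is divisible by the `d`-th power of some variable. -/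
theorem critical_nonempty (n d : ℕ) (σ : Equiv.Perm (Fin n)) (α : CriticalMonomial n d) :
    (Finset.univ.filter fun m : Fin n => d ≤ α.1 (σ m)).Nonempty := by
  by_contra h
  rw [Finset.not_nonempty_iff_eq_empty, Finset.filter_eq_empty_iff] at h
  have hlt : ∀ i : Fin n, α.1 i ≤ d - 1 := fun i => by
    have := h (Finset.mem_univ (σ.symm i))
    rw [Equiv.apply_symm_apply] at this
    omega
  have hsum : ∑ i, α.1 i = n * (d - 1) + 1 := (Finset.mem_finsuppAntidiag.1 α.2).1
  have hle : ∑ i, α.1 i ≤ n * (d - 1) := by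
    calc ∑ i, α.1 i ≤ ∑ _i : Fin n, (d - 1) := Finset.sum_le_sum fun i _ => hlt i
      _ = n * (d - 1) := by simp
  omega

/-- The first variable, in the order `σ 0, σ 1, …`, whose `d`-th power divides the monomial. -/
def leadIndex (n d : ℕ) (σ : Equiv.Perm (Fin n)) (α : CriticalMonomial n d) : Fin n :=
  σ ((Finset.univ.filter fun m : Fin n => d ≤ α.1 (σ m)).min' (critical_nonempty n d σ α))

/-- The Macaulay matrix for the ordering `σ`: the row of `x ^ α` lists the coefficients of
`(x ^ α / x_i ^ d) * F_i`, where `F_i` is the `i`-th generic form and `i` is the first index with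
`x_i ^ d ∣ x ^ α`. -/
def macaulayMatrix (n d : ℕ) (σ : Equiv.Perm (Fin n)) :
    Matrix (CriticalMonomial n d) (CriticalMonomial n d) (CoeffRing n) :=
  Matrix.of fun α β =>
    MvPolynomial.coeff β.1
      (MvPolynomial.monomial (α.1 - Finsupp.single (leadIndex n d σ α) d) 1 *
        genericForm n d (leadIndex n d σ α))

/-- A greatest common divisor of the Macaulay determinants (defined up to a nonzero constant). -/
def macaulayGCD (n d : ℕ) : CoeffRing n :=
  letI : NormalizedGCDMonoid (CoeffRing n) := Classical.arbitrary _
  (Finset.univ : Finset (Equiv.Perm (Fin n))).gcd fun σ => (macaulayMatrix n d σ).det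

/-- The coefficients of the system `x_1 ^ d, …, x_n ^ d`. -/
def fermatPoint (n d : ℕ) : Fin n × (Fin n →₀ ℕ) → ℂ :=
  fun p => if p.2 = Finsupp.single p.1 d then 1 else 0

/-- The generic resultant of `n` forms of degree `d` in `n` variables. -/
def genericResultant (n d : ℕ) : CoeffRing n :=
  MvPolynomial.C (MvPolynomial.eval (fermatPoint n d) (macaulayGCD n d))⁻¹ * macaulayGCD n d

/-- The resultant of `n` forms `F_1, …, F_n` of degree `d` in `n` variables. -/
def resultant {R : Type*} [CommRing R] [Algebra ℂ R] {n : ℕ} (d : ℕ)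
    (F : Fin n → MvPolynomial (Fin n) R) : R :=
  MvPolynomial.aeval (fun p : Fin n × (Fin n →₀ ℕ) => MvPolynomial.coeff p.2 (F p.1))
    (genericResultant n d)

/-! ### Tensors and their spectra -/

/-- A `k`-th order `n`-dimensional tensor with entries in `R`. -/
abbrev Tensor (R : Type*) (k n : ℕ) : Type _ := (Fin k → Fin n) → R

namespace Tensor

variable {k n : ℕ} [NeZero k]

/-- The unit tensor. -/
def unit (R : Type*) [CommRing R] (k n : ℕ) [NeZero k] : Tensor R k n :=
  fun I => if ∀ l, I l = I 0 then 1 else 0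

/-- The vector `T x ^ (k-1)`, with `i`-th entry `∑ T_{i,i_2,…,i_k} x_{i_2} ⋯ x_{i_k}`. -/
def apply (T : Tensor ℂ k n) (x : Fin n → ℂ) : Fin n → ℂ :=
  fun i => ∑ I ∈ Finset.univ.filter (fun I : Fin k → Fin n => I 0 = i),
    T I * ∏ l ∈ Finset.univ.erase (0 : Fin k), x (I l)

/-- `(μ, x)` is an eigenpair of `T`. -/
def IsEigenpair (T : Tensor ℂ k n) (μ : ℂ) (x : Fin n → ℂ) : Prop :=
  x ≠ 0 ∧ ∀ i, T.apply x i = μ * x i ^ (k - 1)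

/-- `μ` is an eigenvalue of `T`. -/
def IsEigenvalue (T : Tensor ℂ k n) (μ : ℂ) : Prop := ∃ x, T.IsEigenpair μ x

/-- The form `(T x ^ (k-1))_i` of degree `k - 1` in the indeterminates `x_1, …, x_n`. -/
def form {R : Type*} [CommRing R] (T : Tensor R k n) (i : Fin n) : MvPolynomial (Fin n) R :=
  ∑ I ∈ Finset.univ.filter (fun I : Fin k → Fin n => I 0 = i),
    MvPolynomial.C (T I) * ∏ l ∈ Finset.univ.erase (0 : Fin k), MvPolynomial.X (I l)

/-- The determinant of a tensor: the resultant of the forms `(T x ^ (k-1))_1, …, (T x ^ (k-1))_n`. -/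
def det {R : Type*} [CommRing R] [Algebra ℂ R] (T : Tensor R k n) : R :=
  resultant (k - 1) T.form

/-- The characteristic polynomial `det (T - λ id)`, as a polynomial in `λ`. -/
def charPoly (T : Tensor ℂ k n) : Polynomial ℂ :=
  det (k := k) (n := n) fun I => Polynomial.C (T I) - Polynomial.X * unit (Polynomial ℂ) k n I

/-- The spectrum: the multiset of roots of the characteristic polynomial. -/
def spec (T : Tensor ℂ k n) : Multiset ℂ := T.charPoly.roots

/-- The algebraic multiplicity. -/
def algMult (T : Tensor ℂ k n) (μ : ℂ) : ℕ := T.charPoly.rootMultiplicity μ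

/-- The eigenvariety of `μ`: the set of its eigenvectors. -/
def eigenvariety (T : Tensor ℂ k n) (μ : ℂ) : Set (Fin n → ℂ) := {x | T.IsEigenpair μ x}

/-- The geometric multiplicity: the dimension of the eigenvariety, that is, the Krull dimension of
the coordinate ring of its Zariski closure. It is `⊥` if `μ` is not an eigenvalue. -/
def geomMult (T : Tensor ℂ k n) (μ : ℂ) : WithBot ℕ∞ :=
  ringKrullDim (MvPolynomial (Fin n) ℂ ⧸ MvPolynomial.vanishingIdeal ℂ (T.eigenvariety μ))

/-- The span multiplicity: the dimension of the linear span of the eigenvectors. -/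
def spanMult (T : Tensor ℂ k n) (μ : ℂ) : ℕ :=
  Module.finrank ℂ (Submodule.span ℂ {x | T.IsEigenpair μ x})

/-- The set of `H`-eigenvalues: real eigenvalues with a real eigenvector. -/
def Hspec (T : Tensor ℂ k n) : Set ℝ :=
  {μ | ∃ x : Fin n → ℝ, T.IsEigenpair (μ : ℂ) fun i => (x i : ℂ)}

end Tensor

/-! ### Weighted hypergraphs and their tensors -/

/-- A weighted hypergraph on `N` vertices, with at least one edge, each edge containing at least two
vertices and having positive weight. The values of `weight` outside `edges` play no role. -/
structure WeightedHypergraph (N : ℕ) where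
  edges : Finset (Finset (Fin N))
  weight : Finset (Fin N) → ℝ
  edges_nonempty : edges.Nonempty
  two_le_card : ∀ e ∈ edges, 2 ≤ e.card
  weight_pos : ∀ e ∈ edges, 0 < weight e

/-- The number of `k`-tuples of indices whose underlying set is a given set of `r` indices, divided
by `r`: the number of such tuples with a prescribed first index. -/
def rowCount (r k : ℕ) : ℝ :=
  (Nat.card {f : Fin k → Fin r // Function.Surjective f} : ℝ) / r

namespace WeightedHypergraph

variable {N : ℕ} (G : WeightedHypergraph N)

/-- The degree of a vertex. -/
def deg (v : Fin N) : ℝ := ∑ e ∈ G.edges.filter (fun e => v ∈ e), G.weight e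

/-- The largest edge cardinality `∇`. -/
def maxCard : ℕ := G.edges.sup Finset.card

instance : NeZero G.maxCard := ⟨by
  obtain ⟨e, he⟩ := G.edges_nonempty
  have h1 := G.two_le_card e he
  have h2 : e.card ≤ G.maxCard := Finset.le_sup (f := Finset.card) he
  omega⟩

/-- The `∇`-th root of the degree of a vertex. -/
def rootDeg (v : Fin N) : ℝ := G.deg v ^ (1 / (G.maxCard : ℝ))

/-- The entries of the adjacency tensor. -/
def adjEntry (I : Fin G.maxCard → Fin N) : ℝ :=
  if Finset.univ.image I ∈ G.edges then
    G.weight (Finset.univ.image I) / rowCount (Finset.univ.image I).card G.maxCard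
  else 0

/-- The normalized Laplacian tensor `L`. The product runs over all `∇` positions, so that repeated
indices are counted with repetition. -/
def normLap : Tensor ℂ G.maxCard N := fun I =>
  if ∀ l, I l = I 0 then 1 else ((-(G.adjEntry I * ∏ l, 1 / G.rootDeg (I l)) : ℝ) : ℂ)

/-- The random walk Laplacian tensor `𝓛`. -/
def rwLap : Tensor ℂ G.maxCard N := fun I =>
  if ∀ l, I l = I 0 then 1 else ((-(G.adjEntry I / G.deg (I 0)) : ℝ) : ℂ)

/-- The signless normalized Laplacian tensor `L⁺`. -/
def signlessNormLap : Tensor ℂ G.maxCard N := fun I =>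
  if ∀ l, I l = I 0 then 1 else ((G.adjEntry I * ∏ l, 1 / G.rootDeg (I l) : ℝ) : ℂ)

/-- The signless random walk Laplacian tensor `𝓛⁺`. -/
def signlessRwLap : Tensor ℂ G.maxCard N := fun I =>
  if ∀ l, I l = I 0 then 1 else ((G.adjEntry I / G.deg (I 0) : ℝ) : ℂ)

end WeightedHypergraph

end

end HypergraphTensor

namespace HypergraphTensor

noncomputable section

open MvPolynomial

/-! ### Invariance of the resultant under rescaling of the variables -/

/-! Let `c j` be the `∇`-th root of `deg v_j`. Since `c i ^ ∇ = deg v_i`, the two tensors of each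
pair are diagonally similar (`IsDiagSimilar`): the entry at `I` changes by the factor `c (I 0) ^ (∇
- 1) / ∏_{l ≠ 0} c (I l)`, which is `1` on the diagonal. Hence `x ↦ x / c` is a linear bijection
between eigenvectors for the same eigenvalue. As `c` is real, it preserves real vectors. This
settles everything but the characteristic polynomials.

For those, the resultant must be invariant under `F_i(x) ↦ c_i ^ d * F_i(x / c)`. This substitution
conjugates every Macaulay matrix by a diagonal matrix, so it fixes the determinants and fixes their
gcd up to a unit. Evaluation at the Fermat system shows that the unit is `1`
(`scaleCoeffs_macaulayGCD`). -/

/-- The value of the monomial `x ^ α` at `c`. -/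
def monomialValue {n : ℕ} (c : Fin n → ℂ) (α : Fin n →₀ ℕ) : ℂ := ∏ j, c j ^ α j

theorem monomialValue_add {n : ℕ} (c : Fin n → ℂ) (α β : Fin n →₀ ℕ) :
    monomialValue c (α + β) = monomialValue c α * monomialValue c β := by
  simp [monomialValue, pow_add, Finset.prod_mul_distrib]

theorem monomialValue_single {n : ℕ} (c : Fin n → ℂ) (i : Fin n) (d : ℕ) :
    monomialValue c (Finsupp.single i d) = c i ^ d := by
  rw [monomialValue, Finset.prod_eq_single i]
  · simp
  · intro j _ hj
    simp [Finsupp.single_eq_of_ne hj]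
  · simp

theorem monomialValue_ne_zero {n : ℕ} {c : Fin n → ℂ} (hc : ∀ j, c j ≠ 0) (α : Fin n →₀ ℕ) :
    monomialValue c α ≠ 0 :=
  Finset.prod_ne_zero_iff.2 fun j _ => pow_ne_zero _ (hc j)

theorem monomialValue_inv {n : ℕ} (c : Fin n → ℂ) (α : Fin n →₀ ℕ) :
    monomialValue c⁻¹ α = (monomialValue c α)⁻¹ := by
  simp [monomialValue, Finset.prod_inv_distrib]

theorem monomialValue_sum {n : ℕ} {ι : Type*} (c : Fin n → ℂ) (s : Finset ι)
    (f : ι → Fin n →₀ ℕ) :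
    monomialValue c (∑ l ∈ s, f l) = ∏ l ∈ s, monomialValue c (f l) := by
  classical
  induction s using Finset.induction_on with
  | empty => simp [monomialValue]
  | insert a s ha ih => rw [Finset.sum_insert ha, Finset.prod_insert ha, monomialValue_add, ih]

/-- The factor by which the coefficient of `x ^ γ` in the `i`-th form changes when the form
`F_i(x)` is replaced by `c_i ^ d * F_i(x / c)`. -/
def scaleFactor {n : ℕ} (c : Fin n → ℂ) (d : ℕ) (p : Fin n × (Fin n →₀ ℕ)) : ℂ :=
  c p.1 ^ d * (monomialValue c p.2)⁻¹

/-- The substitution of the coefficients induced by replacing `F_i(x)` by `c_i ^ d * F_i(x / c)`. -/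
def scaleCoeffs {n : ℕ} (c : Fin n → ℂ) (d : ℕ) : CoeffRing n →ₐ[ℂ] CoeffRing n :=
  aeval fun p => C (scaleFactor c d p) * X p

theorem scaleCoeffs_X {n : ℕ} (c : Fin n → ℂ) (d : ℕ) (p : Fin n × (Fin n →₀ ℕ)) :
    scaleCoeffs c d (X p) = C (scaleFactor c d p) * X p := by
  simp [scaleCoeffs]

theorem scaleCoeffs_scaleCoeffs_inv {n : ℕ} {c : Fin n → ℂ} (hc : ∀ j, c j ≠ 0) (d : ℕ)
    (f : CoeffRing n) : scaleCoeffs c d (scaleCoeffs c⁻¹ d f) = f := by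
  have h : (scaleCoeffs c d).comp (scaleCoeffs c⁻¹ d) = AlgHom.id ℂ (CoeffRing n) := by
    refine MvPolynomial.algHom_ext fun p => ?_
    rw [AlgHom.comp_apply, scaleCoeffs_X, map_mul, scaleCoeffs_X, ← algebraMap_eq,
      AlgHom.commutes, algebraMap_eq, ← mul_assoc, ← C_mul]
    have : scaleFactor c⁻¹ d p * scaleFactor c d p = 1 := by
      have h1 := monomialValue_ne_zero hc p.2
      have h2 := hc p.1
      simp only [scaleFactor, monomialValue_inv, Pi.inv_apply, inv_inv, inv_pow]
      field_simp
    rw [this]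
    simp
  exact DFunLike.congr_fun h f

/-! ### Macaulay determinants under rescaling -/

theorem coeff_genericForm (n d : ℕ) (i : Fin n) (γ : Fin n →₀ ℕ) :
    coeff γ (genericForm n d i) =
      if γ ∈ Finset.finsuppAntidiag Finset.univ d then X (i, γ) else 0 := by
  classical
  simp [genericForm, coeff_sum, coeff_monomial]

theorem le_apply_leadIndex (n d : ℕ) (σ : Equiv.Perm (Fin n)) (α : CriticalMonomial n d) :
    d ≤ α.1 (leadIndex n d σ α) :=
  (Finset.mem_filter.1 (Finset.min'_mem _ (critical_nonempty n d σ α))).2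

theorem sub_single_leadIndex_add (n d : ℕ) (σ : Equiv.Perm (Fin n)) (α : CriticalMonomial n d) :
    α.1 - Finsupp.single (leadIndex n d σ α) d + Finsupp.single (leadIndex n d σ α) d = α.1 :=
  tsub_add_cancel_of_le (Finsupp.single_le_iff.2 (le_apply_leadIndex n d σ α))

/-- With `i` the lead index and `m = α - d e_i`, the entry is `u_{i, β - m}` or `0`, and `c_i ^ d /
c ^ (β - m) = c ^ (m + d e_i) / c ^ β = c ^ α / c ^ β`. -/
theorem scaleCoeffs_macaulayMatrix {n : ℕ} {c : Fin n → ℂ} (hc : ∀ j, c j ≠ 0) (d : ℕ)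
    (σ : Equiv.Perm (Fin n)) (α β : CriticalMonomial n d) :
    scaleCoeffs c d (macaulayMatrix n d σ α β) =
      C (monomialValue c α.1) * macaulayMatrix n d σ α β * C (monomialValue c β.1)⁻¹ := by
  have hα := sub_single_leadIndex_add n d σ α
  simp only [macaulayMatrix, Matrix.of_apply]
  -- How the lead index was chosen is irrelevant: only `hα` is used.
  generalize leadIndex n d σ α = i at *
  rw [coeff_monomial_mul']
  split_ifs with hle
  · rw [coeff_genericForm]
    split_ifs with hmem
    · rw [one_mul, scaleCoeffs_X]
      have hβ := tsub_add_cancel_of_le hle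
      have hm : scaleFactor c d (i, β.1 - (α.1 - Finsupp.single i d)) =
          monomialValue c α.1 * (monomialValue c β.1)⁻¹ := by
        conv_rhs => rw [← hα, ← hβ, monomialValue_add, monomialValue_add, monomialValue_single]
        have h1 := monomialValue_ne_zero hc (α.1 - Finsupp.single i d)
        have h2 := monomialValue_ne_zero hc (β.1 - (α.1 - Finsupp.single i d))
        simp only [scaleFactor]
        field_simp
      rw [hm, C_mul]
      ring
    · simp
  · simp

theorem scaleCoeffs_det_macaulayMatrix {n : ℕ} {c : Fin n → ℂ} (hc : ∀ j, c j ≠ 0) (d : ℕ)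
    (σ : Equiv.Perm (Fin n)) :
    scaleCoeffs c d (macaulayMatrix n d σ).det = (macaulayMatrix n d σ).det := by
  have h : (scaleCoeffs c d).mapMatrix (macaulayMatrix n d σ) =
      Matrix.diagonal (fun α => C (monomialValue c α.1)) * macaulayMatrix n d σ *
        Matrix.diagonal (fun β => C (monomialValue c β.1)⁻¹) := by
    ext1 α β
    rw [Matrix.mul_diagonal, Matrix.diagonal_mul]
    exact scaleCoeffs_macaulayMatrix hc d σ α β
  have hone : (∏ α : CriticalMonomial n d, (C (monomialValue c α.1) : CoeffRing n)) *
      ∏ α : CriticalMonomial n d, C (monomialValue c α.1)⁻¹ = 1 := by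
    rw [← Finset.prod_mul_distrib]
    refine Finset.prod_eq_one fun α _ => ?_
    rw [← C_mul, mul_inv_cancel₀ (monomialValue_ne_zero hc α.1), C_1]
  rw [AlgHom.map_det, h, Matrix.det_mul, Matrix.det_mul, Matrix.det_diagonal, Matrix.det_diagonal,
    mul_right_comm, hone, one_mul]

/-! ### From the determinants to the normalized gcd -/

theorem macaulayGCD_dvd (n d : ℕ) (σ : Equiv.Perm (Fin n)) :
    macaulayGCD n d ∣ (macaulayMatrix n d σ).det := by
  let _ : NormalizedGCDMonoid (CoeffRing n) := Classical.arbitrary _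
  exact Finset.gcd_dvd (f := fun σ => (macaulayMatrix n d σ).det) (Finset.mem_univ σ)

theorem dvd_macaulayGCD {n d : ℕ} {f : CoeffRing n}
    (h : ∀ σ, f ∣ (macaulayMatrix n d σ).det) : f ∣ macaulayGCD n d := by
  let _ : NormalizedGCDMonoid (CoeffRing n) := Classical.arbitrary _
  exact Finset.dvd_gcd fun σ _ => h σ

theorem scaleCoeffs_macaulayGCD_dvd {n : ℕ} {c : Fin n → ℂ} (hc : ∀ j, c j ≠ 0) (d : ℕ) :
    scaleCoeffs c d (macaulayGCD n d) ∣ macaulayGCD n d :=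
  dvd_macaulayGCD fun σ => by
    rw [← scaleCoeffs_det_macaulayMatrix hc d σ]
    exact map_dvd _ (macaulayGCD_dvd n d σ)

/-- For `F_i = x_i ^ d` the row of `x ^ α` represents `(x ^ α / x_i ^ d) * x_i ^ d = x ^ α`, so the
Macaulay matrix is the identity. -/
theorem eval_fermatPoint_det_macaulayMatrix (n d : ℕ) (σ : Equiv.Perm (Fin n)) :
    eval (fermatPoint n d) (macaulayMatrix n d σ).det = 1 := by
  suffices h : (eval (fermatPoint n d)).mapMatrix (macaulayMatrix n d σ) = 1 by
    rw [RingHom.map_det, h, Matrix.det_one]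
  ext1 α β
  have hα := sub_single_leadIndex_add n d σ α
  rw [RingHom.mapMatrix_apply, Matrix.map_apply, Matrix.one_apply]
  simp only [macaulayMatrix, Matrix.of_apply]
  generalize leadIndex n d σ α = i at *
  rw [coeff_monomial_mul']
  by_cases hαβ : α = β
  · subst hαβ
    have hle : α.1 - Finsupp.single i d ≤ α.1 := tsub_le_self
    have hs : α.1 - (α.1 - Finsupp.single i d) = Finsupp.single i d :=
      tsub_eq_of_eq_add_rev hα.symm
    rw [if_pos hle, if_pos rfl, coeff_genericForm, hs, if_pos, one_mul, eval_X, fermatPoint,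
      if_pos rfl]
    rw [Finset.mem_finsuppAntidiag]
    exact ⟨by simp, Finset.subset_univ _⟩
  · rw [if_neg hαβ]
    split_ifs with hle
    · rw [coeff_genericForm]
      split_ifs with hmem
      · rw [one_mul, eval_X, fermatPoint, if_neg]
        intro hs
        refine hαβ (Subtype.ext ?_)
        change β.1 - (α.1 - Finsupp.single i d) = Finsupp.single i d at hs
        have hβ := tsub_add_cancel_of_le hle
        rw [hs, add_comm, hα] at hβ
        exact hβ
      · simp
    · simp

theorem eval_fermatPoint_macaulayGCD_ne_zero (n d : ℕ) :
    eval (fermatPoint n d) (macaulayGCD n d) ≠ 0 := by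
  intro h
  have := map_dvd (eval (fermatPoint n d)) (macaulayGCD_dvd n d 1)
  rw [h, eval_fermatPoint_det_macaulayMatrix, zero_dvd_iff] at this
  exact one_ne_zero this

theorem eval_fermatPoint_scaleCoeffs {n : ℕ} {c : Fin n → ℂ} (hc : ∀ j, c j ≠ 0) (d : ℕ)
    (f : CoeffRing n) :
    eval (fermatPoint n d) (scaleCoeffs c d f) = eval (fermatPoint n d) f := by
  have h : (aeval (fermatPoint n d)).comp (scaleCoeffs c d) =
      (aeval (fermatPoint n d) : CoeffRing n →ₐ[ℂ] ℂ) := by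
    refine MvPolynomial.algHom_ext fun p => ?_
    rw [AlgHom.comp_apply, scaleCoeffs_X, map_mul, aeval_X, aeval_C, Algebra.algebraMap_self,
      RingHom.id_apply, fermatPoint]
    split_ifs with hp
    · rw [scaleFactor, hp, monomialValue_single, mul_inv_cancel₀ (pow_ne_zero _ (hc _)), one_mul]
    · simp
  simpa [aeval_eq_eval] using DFunLike.congr_fun h f

/-- Divisibility for `c` and for `c⁻¹` gives equality up to a unit, that is, a constant. Both sides
have the same nonzero value at the Fermat point, so the constant is `1`. -/
theorem scaleCoeffs_macaulayGCD {n : ℕ} {c : Fin n → ℂ} (hc : ∀ j, c j ≠ 0) (d : ℕ) :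
    scaleCoeffs c d (macaulayGCD n d) = macaulayGCD n d := by
  have h1 := scaleCoeffs_macaulayGCD_dvd hc d
  have h2 : macaulayGCD n d ∣ scaleCoeffs c d (macaulayGCD n d) := by
    have := map_dvd (scaleCoeffs c d)
      (scaleCoeffs_macaulayGCD_dvd (c := c⁻¹) (fun j => inv_ne_zero (hc j)) d)
    rwa [scaleCoeffs_scaleCoeffs_inv hc] at this
  obtain ⟨u, hu⟩ := associated_of_dvd_dvd h1 h2
  obtain ⟨a, -, ha⟩ := MvPolynomial.isUnit_iff_eq_C_of_isReduced.1 u.isUnit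
  have hev := congrArg (eval (fermatPoint n d)) hu
  rw [ha, map_mul, eval_C, eval_fermatPoint_scaleCoeffs hc] at hev
  have ha1 : a = 1 := mul_left_cancel₀ (eval_fermatPoint_macaulayGCD_ne_zero n d)
    (hev.trans (mul_one _).symm)
  rwa [ha, ha1, C_1, mul_one] at hu

theorem scaleCoeffs_genericResultant {n : ℕ} {c : Fin n → ℂ} (hc : ∀ j, c j ≠ 0) (d : ℕ) :
    scaleCoeffs c d (genericResultant n d) = genericResultant n d := by
  rw [genericResultant, map_mul, scaleCoeffs_macaulayGCD hc, ← algebraMap_eq, AlgHom.commutes]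

/-- The resultant does not change when each form `F_i(x)` is replaced by `c_i ^ d * F_i(x / c)`. -/
theorem resultant_eq_of_coeff_eq {R : Type*} [CommRing R] [Algebra ℂ R] {n : ℕ} {c : Fin n → ℂ}
    (hc : ∀ j, c j ≠ 0) (d : ℕ) {F F' : Fin n → MvPolynomial (Fin n) R}
    (h : ∀ i γ, coeff γ (F' i) = algebraMap ℂ R (scaleFactor c d (i, γ)) * coeff γ (F i)) :
    resultant d F' = resultant d F := by
  have hcomp : (aeval fun p : Fin n × (Fin n →₀ ℕ) => coeff p.2 (F p.1)).comp (scaleCoeffs c d) =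
      (aeval fun p : Fin n × (Fin n →₀ ℕ) => coeff p.2 (F' p.1) : CoeffRing n →ₐ[ℂ] R) := by
    refine MvPolynomial.algHom_ext fun p => ?_
    rw [AlgHom.comp_apply, scaleCoeffs_X, map_mul, aeval_X, aeval_C, aeval_X, h]
  rw [resultant, resultant, ← hcomp, AlgHom.comp_apply, scaleCoeffs_genericResultant hc]

/-! ### Diagonally similar tensors -/

namespace Tensor

variable {k n : ℕ} [NeZero k]

/-- `S` arises from `T` by the diagonal similarity with diagonal entries `c`. -/
def IsDiagSimilar (c : Fin n → ℂ) (S T : Tensor ℂ k n) : Prop :=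
  ∀ I, S I = c (I 0) ^ (k - 1) * (∏ l ∈ Finset.univ.erase (0 : Fin k), c (I l))⁻¹ * T I

theorem coeff_form {R : Type*} [CommRing R] (T : Tensor R k n) (i : Fin n) (γ : Fin n →₀ ℕ) :
    coeff γ (T.form i) = ∑ I ∈ Finset.univ.filter (fun I : Fin k → Fin n => I 0 = i),
      if ∑ l ∈ Finset.univ.erase (0 : Fin k), Finsupp.single (I l) 1 = γ then T I else 0 := by
  classical
  simp only [form, coeff_sum, coeff_C_mul]
  refine Finset.sum_congr rfl fun I _ => ?_
  have : (∏ l ∈ Finset.univ.erase (0 : Fin k), X (I l) : MvPolynomial (Fin n) R) =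
      monomial (∑ l ∈ Finset.univ.erase (0 : Fin k), Finsupp.single (I l) 1) 1 := by
    rw [monomial_sum_one]
    rfl
  rw [this, coeff_monomial, mul_ite, mul_one, mul_zero]

variable {c : Fin n → ℂ} {S T : Tensor ℂ k n}

theorem prod_erase_of_diagonal (c : Fin n → ℂ) {I : Fin k → Fin n} (hI : ∀ l, I l = I 0) :
    ∏ l ∈ Finset.univ.erase (0 : Fin k), c (I l) = c (I 0) ^ (k - 1) := by
  rw [Finset.prod_congr rfl fun l _ => by rw [hI l], Finset.prod_const,
    Finset.card_erase_of_mem (Finset.mem_univ _), Finset.card_univ, Fintype.card_fin]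

/-- The similarity factor of the entry at `I` depends only on `I 0` and on the monomial to which the
entry contributes, and equals `scaleFactor` there. -/
theorem IsDiagSimilar.charPoly_eq (hc : ∀ j, c j ≠ 0) (h : IsDiagSimilar c S T) :
    S.charPoly = T.charPoly := by
  refine resultant_eq_of_coeff_eq hc (k - 1) fun i γ => ?_
  rw [coeff_form, coeff_form, Finset.mul_sum]
  refine Finset.sum_congr rfl fun I hI => ?_
  obtain rfl := (Finset.mem_filter.1 hI).2
  split_ifs with hγ
  · have hw : scaleFactor c (k - 1) (I 0, γ) =
        c (I 0) ^ (k - 1) * (∏ l ∈ Finset.univ.erase (0 : Fin k), c (I l))⁻¹ := by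
      simp only [scaleFactor, ← hγ, monomialValue_sum, monomialValue_single, pow_one]
    rw [hw, h I, Polynomial.algebraMap_apply, Algebra.algebraMap_self, RingHom.id_apply, mul_sub,
      ← Polynomial.C_mul]
    congr 1
    -- The unit tensor is similar to itself, so the term in `λ` is unaffected.
    rw [unit]
    split_ifs with hd
    · rw [prod_erase_of_diagonal c hd, mul_inv_cancel₀ (pow_ne_zero _ (hc _)), Polynomial.C_1,
        one_mul]
    · simp
  · simp

/-! ### Eigenvectors, multiplicities and `H`-spectra -/

theorem IsDiagSimilar.apply_eq (h : IsDiagSimilar c S T) (x : Fin n → ℂ) (i : Fin n) :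
    S.apply x i = c i ^ (k - 1) * T.apply (fun j => x j / c j) i := by
  rw [apply, apply, Finset.mul_sum]
  refine Finset.sum_congr rfl fun I hI => ?_
  obtain rfl := (Finset.mem_filter.1 hI).2
  rw [h I, Finset.prod_div_distrib]
  ring

theorem IsDiagSimilar.isEigenpair_iff (hc : ∀ j, c j ≠ 0) (h : IsDiagSimilar c S T) (μ : ℂ)
    (x : Fin n → ℂ) : S.IsEigenpair μ x ↔ T.IsEigenpair μ fun j => x j / c j := by
  refine and_congr (not_congr ?_) (forall_congr' fun i => ?_)
  · simp [funext_iff, hc]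
  · have hci := pow_ne_zero (k - 1) (hc i)
    rw [h.apply_eq, div_pow, ← mul_right_inj' hci (b := T.apply (fun j => x j / c j) i)]
    have : c i ^ (k - 1) * (μ * (x i ^ (k - 1) / c i ^ (k - 1))) = μ * x i ^ (k - 1) := by
      field_simp
    rw [this]

/-- Entrywise division by a nowhere vanishing vector, as a linear equivalence. -/
def divEquiv (hc : ∀ j, c j ≠ 0) : (Fin n → ℂ) ≃ₗ[ℂ] (Fin n → ℂ) :=
  LinearEquiv.piCongrRight fun j => LinearEquiv.smulOfNeZero ℂ ℂ (c j)⁻¹ (inv_ne_zero (hc j))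

theorem divEquiv_apply (hc : ∀ j, c j ≠ 0) (x : Fin n → ℂ) :
    divEquiv hc x = fun j => x j / c j := by
  ext j
  simp [divEquiv, div_eq_inv_mul]

theorem IsDiagSimilar.image_eigenvariety (hc : ∀ j, c j ≠ 0) (h : IsDiagSimilar c S T) (μ : ℂ) :
    divEquiv hc '' S.eigenvariety μ = T.eigenvariety μ := by
  ext y
  obtain ⟨x, rfl⟩ := (divEquiv hc).surjective y
  rw [(divEquiv hc).injective.mem_set_image, divEquiv_apply]
  exact h.isEigenpair_iff hc μ x

theorem IsDiagSimilar.isEigenvalue_iff (hc : ∀ j, c j ≠ 0) (h : IsDiagSimilar c S T) (μ : ℂ) :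
    S.IsEigenvalue μ ↔ T.IsEigenvalue μ := by
  change (S.eigenvariety μ).Nonempty ↔ (T.eigenvariety μ).Nonempty
  rw [← h.image_eigenvariety hc, Set.image_nonempty]

theorem IsDiagSimilar.spanMult_eq (hc : ∀ j, c j ≠ 0) (h : IsDiagSimilar c S T) (μ : ℂ) :
    S.spanMult μ = T.spanMult μ := by
  change Module.finrank ℂ (Submodule.span ℂ (S.eigenvariety μ)) =
    Module.finrank ℂ (Submodule.span ℂ (T.eigenvariety μ))
  rw [← h.image_eigenvariety hc, ← LinearEquiv.coe_coe, Submodule.span_image,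
    LinearEquiv.finrank_map_eq]

/-- The automorphism of the polynomial ring with `X j ↦ c j * X j`. -/
def scaleVars (hc : ∀ j, c j ≠ 0) : MvPolynomial (Fin n) ℂ ≃ₐ[ℂ] MvPolynomial (Fin n) ℂ :=
  AlgEquiv.ofAlgHom (aeval fun j => C (c j) * X j) (aeval fun j => C (c j)⁻¹ * X j)
    (MvPolynomial.algHom_ext fun j => by
      simp [← mul_assoc, ← C_mul, hc j, algebraMap_eq])
    (MvPolynomial.algHom_ext fun j => by
      simp [← mul_assoc, ← C_mul, hc j, algebraMap_eq])

theorem aeval_scaleVars (hc : ∀ j, c j ≠ 0) (x : Fin n → ℂ) (p : MvPolynomial (Fin n) ℂ) :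
    aeval (divEquiv hc x) (scaleVars hc p) = aeval x p := by
  have h : (aeval (divEquiv hc x)).comp (scaleVars hc : MvPolynomial (Fin n) ℂ →ₐ[ℂ] _) =
      (aeval x : MvPolynomial (Fin n) ℂ →ₐ[ℂ] ℂ) := by
    refine MvPolynomial.algHom_ext fun j => ?_
    simp [scaleVars, divEquiv_apply, mul_div_cancel₀, hc j]
  exact DFunLike.congr_fun h p

/-- By `aeval_scaleVars`, `scaleVars` carries the vanishing ideal of one eigenvariety onto that of
the other, so the coordinate rings are isomorphic. -/
theorem IsDiagSimilar.geomMult_eq (hc : ∀ j, c j ≠ 0) (h : IsDiagSimilar c S T) (μ : ℂ) :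
    S.geomMult μ = T.geomMult μ := by
  have hmem (p : MvPolynomial (Fin n) ℂ) : scaleVars hc p ∈ vanishingIdeal ℂ (T.eigenvariety μ) ↔
      p ∈ vanishingIdeal ℂ (S.eigenvariety μ) := by
    simp only [mem_vanishingIdeal_iff, ← h.image_eigenvariety hc, Set.forall_mem_image,
      aeval_scaleVars]
  refine ringKrullDim_eq_of_ringEquiv (Ideal.quotientEquiv _ _ (scaleVars hc).toRingEquiv ?_)
  ext q
  obtain ⟨p, rfl⟩ := (scaleVars hc).surjective q
  rw [hmem]
  exact (Ideal.mem_map_of_equiv (scaleVars hc).toRingEquiv _).trans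
    ⟨fun ⟨a, ha, e⟩ => (scaleVars hc).injective e ▸ ha, fun hp => ⟨p, hp, rfl⟩⟩ |>.symm

theorem IsDiagSimilar.Hspec_eq {r : Fin n → ℝ} (hr : ∀ j, r j ≠ 0)
    (h : IsDiagSimilar (fun j => (r j : ℂ)) S T) : S.Hspec = T.Hspec := by
  have hc : ∀ j, (r j : ℂ) ≠ 0 := fun j => Complex.ofReal_ne_zero.2 (hr j)
  ext μ
  constructor
  · rintro ⟨x, hx⟩
    refine ⟨fun j => x j / r j, ?_⟩
    simpa using (h.isEigenpair_iff hc μ _).1 hx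
  · rintro ⟨y, hy⟩
    refine ⟨fun j => y j * r j, (h.isEigenpair_iff hc μ _).2 ?_⟩
    simpa [hc] using hy

end Tensor

/-! ### The Laplacians of a hypergraph -/

namespace WeightedHypergraph

variable {N : ℕ} (G : WeightedHypergraph N)

theorem rootDeg_pos (hdeg : ∀ v, 0 < G.deg v) (v : Fin N) : 0 < G.rootDeg v :=
  Real.rpow_pos_of_pos (hdeg v) _

theorem rootDeg_pow_maxCard (hdeg : ∀ v, 0 < G.deg v) (v : Fin N) :
    G.rootDeg v ^ G.maxCard = G.deg v := by
  rw [rootDeg, one_div, Real.rpow_inv_natCast_pow (hdeg v).le (NeZero.ne _)]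

/-- The factor at position `0` is split off and rewritten by `1 / r = r ^ (∇ - 1) / r ^ ∇`, where `r
^ ∇` is the degree. -/
theorem prod_one_div_rootDeg (hdeg : ∀ v, 0 < G.deg v) (I : Fin G.maxCard → Fin N) :
    ∏ l, 1 / G.rootDeg (I l) = G.rootDeg (I 0) ^ (G.maxCard - 1) *
      (∏ l ∈ Finset.univ.erase (0 : Fin G.maxCard), G.rootDeg (I l))⁻¹ * (1 / G.deg (I 0)) := by
  have h0 := (G.rootDeg_pos hdeg (I 0)).ne'
  have hk : G.maxCard = G.maxCard - 1 + 1 := (Nat.sub_add_cancel NeZero.one_le).symm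
  have hd : G.deg (I 0) = G.rootDeg (I 0) ^ (G.maxCard - 1) * G.rootDeg (I 0) := by
    rw [← pow_succ, ← hk, G.rootDeg_pow_maxCard hdeg]
  rw [← Finset.mul_prod_erase _ _ (Finset.mem_univ (0 : Fin G.maxCard)), hd,
    ← Finset.prod_inv_distrib]
  simp only [one_div]
  field_simp

/-- Leaving `a` arbitrary treats both signs at once: `a` is `-G.adjEntry` or `G.adjEntry`. -/
theorem isDiagSimilar_of_offDiagonal (hdeg : ∀ v, 0 < G.deg v)
    (a : (Fin G.maxCard → Fin N) → ℝ) {S T : Tensor ℂ G.maxCard N}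
    (hS : ∀ I, S I = if ∀ l, I l = I 0 then 1 else
      ((a I * ∏ l, 1 / G.rootDeg (I l) : ℝ) : ℂ))
    (hT : ∀ I, T I = if ∀ l, I l = I 0 then 1 else ((a I / G.deg (I 0) : ℝ) : ℂ)) :
    Tensor.IsDiagSimilar (fun j => (G.rootDeg j : ℂ)) S T := by
  intro I
  rw [hS, hT]
  split_ifs with hI
  · rw [Tensor.prod_erase_of_diagonal (fun j => (G.rootDeg j : ℂ)) hI, mul_one, mul_inv_cancel₀]
    exact pow_ne_zero _ (Complex.ofReal_ne_zero.2 (G.rootDeg_pos hdeg _).ne')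
  · rw [G.prod_one_div_rootDeg hdeg]
    push_cast
    ring

theorem isDiagSimilar_normLap_rwLap (hdeg : ∀ v, 0 < G.deg v) :
    Tensor.IsDiagSimilar (fun j => (G.rootDeg j : ℂ)) G.normLap G.rwLap :=
  G.isDiagSimilar_of_offDiagonal hdeg (fun I => -G.adjEntry I)
    (fun I => by rw [normLap, neg_mul]) (fun I => by rw [rwLap, neg_div])

theorem isDiagSimilar_signlessNormLap_signlessRwLap (hdeg : ∀ v, 0 < G.deg v) :
    Tensor.IsDiagSimilar (fun j => (G.rootDeg j : ℂ)) G.signlessNormLap G.signlessRwLap :=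
  G.isDiagSimilar_of_offDiagonal hdeg G.adjEntry (fun _ => rfl) (fun _ => rfl)

end WeightedHypergraph

end

end HypergraphTensor

theorem mainTheorem3 {N : ℕ} (G : HypergraphTensor.WeightedHypergraph N)
    (hdeg : ∀ v, 0 < G.deg v) :
    ((G.normLap.spec = G.rwLap.spec) ∧
      (∀ μ : ℂ, G.normLap.IsEigenvalue μ ↔ G.rwLap.IsEigenvalue μ) ∧
      (∀ μ : ℂ, G.normLap.algMult μ = G.rwLap.algMult μ) ∧
      (∀ (μ : ℂ) (x : Fin N → ℂ),
        G.normLap.IsEigenpair μ x ↔ G.rwLap.IsEigenpair μ fun j => x j / (G.rootDeg j : ℂ)) ∧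
      (∀ μ : ℂ, G.normLap.geomMult μ = G.rwLap.geomMult μ) ∧
      (∀ μ : ℂ, G.normLap.spanMult μ = G.rwLap.spanMult μ) ∧
      G.normLap.Hspec = G.rwLap.Hspec) ∧
    ((G.signlessNormLap.spec = G.signlessRwLap.spec) ∧
      (∀ μ : ℂ, G.signlessNormLap.IsEigenvalue μ ↔ G.signlessRwLap.IsEigenvalue μ) ∧
      (∀ μ : ℂ, G.signlessNormLap.algMult μ = G.signlessRwLap.algMult μ) ∧
      (∀ (μ : ℂ) (x : Fin N → ℂ),
        G.signlessNormLap.IsEigenpair μ x ↔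
          G.signlessRwLap.IsEigenpair μ fun j => x j / (G.rootDeg j : ℂ)) ∧
      (∀ μ : ℂ, G.signlessNormLap.geomMult μ = G.signlessRwLap.geomMult μ) ∧
      (∀ μ : ℂ, G.signlessNormLap.spanMult μ = G.signlessRwLap.spanMult μ) ∧
      G.signlessNormLap.Hspec = G.signlessRwLap.Hspec) := by
  have hr : ∀ j, G.rootDeg j ≠ 0 := fun j => (G.rootDeg_pos hdeg j).ne'
  have hc : ∀ j, (G.rootDeg j : ℂ) ≠ 0 := fun j => Complex.ofReal_ne_zero.2 (hr j)
  have h := G.isDiagSimilar_normLap_rwLap hdeg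
  have h' := G.isDiagSimilar_signlessNormLap_signlessRwLap hdeg
  exact ⟨⟨congrArg Polynomial.roots (h.charPoly_eq hc), h.isEigenvalue_iff hc,
      fun μ => congrArg (Polynomial.rootMultiplicity μ) (h.charPoly_eq hc), h.isEigenpair_iff hc,
      h.geomMult_eq hc, h.spanMult_eq hc, h.Hspec_eq hr⟩,
    ⟨congrArg Polynomial.roots (h'.charPoly_eq hc), h'.isEigenvalue_iff hc,
      fun μ => congrArg (Polynomial.rootMultiplicity μ) (h'.charPoly_eq hc),
      h'.isEigenpair_iff hc, h'.geomMult_eq hc, h'.spanMult_eq hc, h'.Hspec_eq hr⟩⟩
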